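/- Let $H$ be a complex Hilbert space, let $B(H)_+$ be the cone of positive semi-definite bounded operators on $H$, and let $p>1$ be a real number. A map $F$ from a set $s\subseteq(0,\infty)$ to $B(H)$ is weakly measurable if $x\mapsto\langle\xi,F(x)\eta\rangle$ is Lebesgue measurable for all $\xi,\eta\in H$. The integral $\int_s F(x)\,dx$ is said to define the bounded operator $T$ if for all $\xi,\eta\in H$ the function $x\mapsto\langle\xi,F(x)\eta\rangle$ is integrable on $s$ with integral $\langle\xi,T\eta\rangle$. (i) Let $f\colon(0,\infty)\to B(H)_+$ be weakly measurable and such that $\int_0^\infty f(x)^p\,dx$ defines a bounded linear trace class operator on $H$. Then $\int_0^x f(t)\,dt$ defines a bounded operator for every $x>0$, the integral $\int_0^\infty\bigl(\frac1x\int_0^x f(t)\,dt\bigr)^p\,dx$ defines a bounded linear trace class operator on $H$, and $$\operatorname{Tr}\int_0^\infty\Bigl(\frac1x\int_0^x f(t)\,dt\Bigr)^p dx\le\Bigl(\frac p{p-1}\Bigr)^p\operatorname{Tr}\int_0^\infty f(x)^p\,dx .$$ (ii) The constant $(p/(p-1))^p$ is the best possible: if $H\ne\{0\}$ and $C$ is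 a real number such that $$\operatorname{Tr}\int_0^\infty\Bigl(\frac1x\int_0^x f(t)\,dt\Bigr)^p dx\le C\operatorname{Tr}\int_0^\infty f(x)^p\,dx$$ for all $f$ as in (i), then $C\ge(p/(p-1))^p$. -/

import Mathlib

open MeasureTheory Set

noncomputable section

namespace TracialHardy

variable {H : Type*} [NormedAddCommGroup H] [InnerProductSpace ℂ H] [CompleteSpace H]

/-- `F` is weakly (Lebesgue) measurable on `s`: all its matrix coefficients are measurable on `s`. -/
def WeaklyMeasurableOn (F : ℝ → H →L[ℂ] H) (s : Set ℝ) : Prop :=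
  ∀ ξ η : H, AEMeasurable (fun x => inner ℂ ξ (F x η)) (volume.restrict s)

/-- The weak integral `∫ x in s, F x` exists and is the bounded operator `T`. -/
def HasWeakIntegral (F : ℝ → H →L[ℂ] H) (s : Set ℝ) (T : H →L[ℂ] H) : Prop :=
  ∀ ξ η : H, IntegrableOn (fun x => inner ℂ ξ (F x η)) s volume ∧
    ∫ x in s, inner ℂ ξ (F x η) = inner ℂ ξ (T η)

/-- The weak integral of `F` over `s` defines a bounded linear operator. -/
def WeaklyIntegrableOn (F : ℝ → H →L[ℂ] H) (s : Set ℝ) : Prop :=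
  ∃ T : H →L[ℂ] H, HasWeakIntegral F s T

open Classical in
/-- The bounded operator defined by the weak integral of `F` over `s`
(`0` if the integral does not define a bounded operator). -/
def weakIntegral (F : ℝ → H →L[ℂ] H) (s : Set ℝ) : H →L[ℂ] H :=
  if h : WeaklyIntegrableOn F s then h.choose else 0

theorem HasWeakIntegral.unique {F : ℝ → H →L[ℂ] H} {s : Set ℝ} {S T : H →L[ℂ] H}
    (hS : HasWeakIntegral F s S) (hT : HasWeakIntegral F s T) : S = T := by
  ext η
  exact ext_inner_left ℂ fun ξ => (hS ξ η).2.symm.trans (hT ξ η).2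

theorem HasWeakIntegral.weakIntegral_eq {F : ℝ → H →L[ℂ] H} {s : Set ℝ} {T : H →L[ℂ] H}
    (hT : HasWeakIntegral F s T) : weakIntegral F s = T := by
  have h : WeaklyIntegrableOn F s := ⟨T, hT⟩
  rw [weakIntegral, dif_pos h]
  exact h.choose_spec.unique hT

/-- `T` is trace class: `∑ᵢ ⟨eᵢ, |T| eᵢ⟩ < ∞` for every orthonormal basis, `|T| = (T* T)^{1/2}`. -/
def IsTraceClass (T : H →L[ℂ] H) : Prop :=
  ∀ (w : Set H) (b : HilbertBasis w ℂ H),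
    Summable fun i => (inner ℂ (b i) (CFC.abs T (b i))).re

variable (H) in
/-- The index set of a fixed orthonormal basis of `H`. -/
def basisIndex : Set H := (exists_hilbertBasis ℂ H).choose

variable (H) in
/-- A fixed orthonormal basis of `H`. -/
def onb : HilbertBasis (basisIndex H) ℂ H := (exists_hilbertBasis ℂ H).choose_spec.choose

/-- The trace `∑ᵢ ⟨eᵢ, T eᵢ⟩` (for trace class `T` independent of the orthonormal basis). -/
def trace (T : H →L[ℂ] H) : ℂ := ∑' i, inner ℂ (onb H i) (T (onb H i))

/-- The averages `(1/x) ∫₀ˣ f(t) dt`. -/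
def hardyMean (f : ℝ → H →L[ℂ] H) (x : ℝ) : H →L[ℂ] H :=
  x⁻¹ • weakIntegral f (Ioc 0 x)

end TracialHardy

end

/-!
The inequality is reduced to scalar functions through the diagonal values `⟨ξ, T ξ⟩` (`quad`) of
positive operators `T`.

*Trace estimate at a fixed `x`.* For a unit vector `ξ`, Jensen's inequality for the vector state of
`ξ` (`quad_rpow_le`) gives `⟨ξ, f(t) ξ⟩ ^ p ≤ ⟨ξ, f(t) ^ p ξ⟩`. Hölder's inequality on `(0, x]` with
weight `t ^ (1 / q)`, where `q = p / (p - 1)` (`lintegral_Ioc_rpow_le`), then bounds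
`⟨ξ, A ξ⟩ ^ p`, where `A` is the average of `f` over `(0, x]`, by a multiple of `⟨ξ, S ξ⟩`, with `S`
the weak integral of `t ^ (1 / q) f(t) ^ p` over `(0, x]`. As `S` is trace class, `A` is compact
(`isCompactOperator_of_quad_le`) and so diagonal in some orthonormal basis. In an eigenbasis of `A`
the numbers `⟨ξ, A ξ⟩ ^ p` are the diagonal values of `A ^ p`, so that summing over it bounds
`Tr A ^ p` by a multiple of `Tr S` (`tsum_quad_rpow_le`). Operator convexity of `t ↦ t ^ p`, which
fails for `p > 2`, is not needed.

*Integration over `x`.* Traces of positive operators do not depend on the basis (`tsum_quad_eq`), so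
the estimates for different `x` can be compared in one fixed basis. The space need not be separable,
but only countably many vectors of that basis contribute to the trace of `∫ f ^ p`, and Tonelli's
theorem gives the constant `q ^ p` (`lintegral_hardyKernel_mul`,
`lintegral_tsum_quad_hardyMean_le`).

*Existence of the integrals.* A weakly measurable family of positive operators whose integrated
quadratic form is bounded has a weak integral (`weaklyIntegrableOn_of_lintegral_quad_le`). The
powers of the averages are weakly measurable because the averages are continuous in norm
(`norm_weakIntegral_sub_le`, `continuousOn_hardyMean`).

*Sharpness.* The functions `t ^ (-a)` on `(0, 1]` times a rank one projection have ratio at least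
`(1 - a) ^ (-p)`, which tends to `(p / (p - 1)) ^ p` as `a` increases to `1 / p`
(`le_of_hardy_trace_inequality`).
-/

noncomputable section

namespace TracialHardy

open scoped ENNReal

universe u

/-! ### Diagonal values and traces of positive operators -/

section

variable {H : Type u} [NormedAddCommGroup H] [InnerProductSpace ℂ H]

/-- The diagonal value `⟨ξ, T ξ⟩` as an extended nonnegative number, so that sums and integrals of
diagonal values always exist. The real part is taken and negative values are truncated to `0`, which
changes nothing for positive `T`. -/
def quad (T : H →L[ℂ] H) (ξ : H) : ℝ≥0∞ := ENNReal.ofReal (inner ℂ ξ (T ξ)).re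

theorem re_inner_nonneg {T : H →L[ℂ] H} (hT : 0 ≤ T) (ξ : H) : 0 ≤ (inner ℂ ξ (T ξ)).re :=
  ((ContinuousLinearMap.nonneg_iff_isPositive T).1 hT).re_inner_nonneg_right ξ

theorem inner_eq_re {T : H →L[ℂ] H} (hT : 0 ≤ T) (ξ : H) :
    inner ℂ ξ (T ξ) = ((inner ℂ ξ (T ξ)).re : ℂ) := by
  have h := ((ContinuousLinearMap.nonneg_iff_isPositive T).1 hT).inner_nonneg_right ξ
  exact Complex.eq_re_of_ofReal_le (r := 0) (by simpa using h)

theorem nonneg_of_inner {T : H →L[ℂ] H}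
    (h : ∀ ξ : H, ∃ r : ℝ, 0 ≤ r ∧ inner ℂ ξ (T ξ) = (r : ℂ)) : 0 ≤ T := by
  rw [ContinuousLinearMap.nonneg_iff_isPositive, ContinuousLinearMap.isPositive_iff_complex]
  intro ξ
  obtain ⟨r, hr, h⟩ := h ξ
  rw [← inner_conj_symm, h]
  simp [hr]

theorem re_inner_mono {S T : H →L[ℂ] H} (h : S ≤ T) (ξ : H) :
    (inner ℂ ξ (S ξ)).re ≤ (inner ℂ ξ (T ξ)).re := by
  have := ((ContinuousLinearMap.le_def S T).1 h).re_inner_nonneg_right ξ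
  simpa [inner_sub_right] using this

theorem norm_smul_normalized (ξ : H) : ((‖ξ‖ : ℝ) : ℂ) • (((‖ξ‖⁻¹ : ℝ) : ℂ) • ξ) = ξ := by
  rcases eq_or_ne ξ 0 with rfl | h0
  · simp
  · rw [smul_smul, ← Complex.ofReal_mul, mul_inv_cancel₀ (norm_ne_zero_iff.2 h0)]
    simp

theorem norm_normalized {ξ : H} (h : ξ ≠ 0) : ‖((‖ξ‖⁻¹ : ℝ) : ℂ) • ξ‖ = 1 := by
  rw [norm_smul]
  simp [norm_ne_zero_iff.2 h]

theorem quad_smul (T : H →L[ℂ] H) (ξ : H) {r : ℝ} (hr : 0 ≤ r) :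
    quad (r • T) ξ = ENNReal.ofReal r * quad T ξ := by
  rw [quad, quad, ← ENNReal.ofReal_mul hr]
  simp [inner_smul_right_eq_smul]

theorem quad_smul_vec (T : H →L[ℂ] H) (ξ : H) (c : ℝ) :
    quad T ((c : ℂ) • ξ) = ENNReal.ofReal (c ^ 2) * quad T ξ := by
  rw [quad, quad, ← ENNReal.ofReal_mul (sq_nonneg c)]
  congr 1
  simp only [map_smul, inner_smul_left, inner_smul_right, Complex.conj_ofReal]
  rw [← mul_assoc, ← Complex.ofReal_mul, Complex.re_ofReal_mul, sq]

/-- Parseval's identity in `[0, ∞]`. -/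
theorem tsum_ofReal_norm_inner_sq {ι : Type*} (b : HilbertBasis ι ℂ H) (ξ : H) :
    ∑' i, ENNReal.ofReal (‖inner ℂ (b i) ξ‖ ^ 2) = ENNReal.ofReal (‖ξ‖ ^ 2) := by
  have h := b.hasSum_inner_mul_inner ξ ξ
  have h2 : HasSum (fun i => ‖inner ℂ (b i) ξ‖ ^ 2) (‖ξ‖ ^ 2) := by
    have := Complex.hasSum_re h
    rw [inner_self_eq_norm_sq_to_K] at this
    convert this using 1
    · ext i
      rw [← inner_conj_symm ξ (b i), Complex.conj_mul']
      norm_cast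
    · norm_cast
  rw [← h2.tsum_eq, ENNReal.ofReal_tsum_of_nonneg (fun i => sq_nonneg _) h2.summable]

variable [CompleteSpace H]

theorem norm_le_of_re_inner_le {T : H →L[ℂ] H} (hT : 0 ≤ T) {M : ℝ} (hM : 0 ≤ M)
    (h : ∀ ξ : H, (inner ℂ ξ (T ξ)).re ≤ M * ‖ξ‖ ^ 2) : ‖T‖ ≤ M := by
  rw [CStarAlgebra.norm_le_iff_le_algebraMap T hM hT]
  rw [← sub_nonneg]
  refine nonneg_of_inner fun ξ => ⟨M * ‖ξ‖ ^ 2 - (inner ℂ ξ (T ξ)).re, sub_nonneg.2 (h ξ), ?_⟩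
  rw [_root_.sub_apply, inner_sub_right, inner_eq_re hT ξ, Algebra.algebraMap_eq_smul_one]
  simp [inner_smul_right_eq_smul, inner_self_eq_norm_sq_to_K]

theorem sqrt_isSelfAdjoint (T : H →L[ℂ] H) : IsSelfAdjoint (CFC.sqrt T) :=
  (CFC.sqrt_nonneg T).isSelfAdjoint

theorem inner_sqrt_left (T : H →L[ℂ] H) (ξ η : H) :
    inner ℂ (CFC.sqrt T ξ) η = inner ℂ ξ (CFC.sqrt T η) := by
  have := ContinuousLinearMap.isSelfAdjoint_iff_isSymmetric.1 (sqrt_isSelfAdjoint T)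
  exact this ξ η

theorem quad_eq_norm_sqrt {T : H →L[ℂ] H} (hT : 0 ≤ T) (ξ : H) :
    quad T ξ = ENNReal.ofReal (‖CFC.sqrt T ξ‖ ^ 2) := by
  have h : T ξ = CFC.sqrt T (CFC.sqrt T ξ) := by
    conv_lhs => rw [← CFC.sqrt_mul_sqrt_self T hT]
    rfl
  rw [quad, h, ← inner_sqrt_left, inner_self_eq_norm_sq_to_K]
  norm_cast

/-- The trace of a positive operator does not depend on the orthonormal basis: both sums are the
double sum of `|⟨cⱼ, T^{1/2} bᵢ⟩|²`. -/
theorem tsum_quad_eq {ι κ : Type*} (b : HilbertBasis ι ℂ H) (c : HilbertBasis κ ℂ H)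
    {T : H →L[ℂ] H} (hT : 0 ≤ T) : ∑' i, quad T (b i) = ∑' j, quad T (c j) := by
  simp_rw [quad_eq_norm_sqrt hT]
  simp_rw [← tsum_ofReal_norm_inner_sq c (CFC.sqrt T (b _))]
  rw [ENNReal.tsum_comm]
  refine tsum_congr fun j => ?_
  rw [← tsum_ofReal_norm_inner_sq b]
  refine tsum_congr fun i => ?_
  rw [← inner_sqrt_left, norm_inner_symm]

/-- The square root of a positive operator has operator norm at most its Hilbert-Schmidt norm. -/
theorem quad_le_tsum {ι : Type*} (b : HilbertBasis ι ℂ H) {T : H →L[ℂ] H} (hT : 0 ≤ T) (ξ : H) :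
    quad T ξ ≤ ENNReal.ofReal (‖ξ‖ ^ 2) * ∑' i, quad T (b i) := by
  rw [quad_eq_norm_sqrt hT, ← tsum_ofReal_norm_inner_sq b, ← ENNReal.tsum_mul_left]
  refine ENNReal.tsum_le_tsum fun i => ?_
  rw [quad_eq_norm_sqrt hT, ← ENNReal.ofReal_mul (by positivity), ← inner_sqrt_left, ← mul_pow,
    mul_comm]
  gcongr
  exact norm_inner_le_norm _ _

/-! ### Powers of positive operators on vectors -/

theorem opRpow_nonneg (T : H →L[ℂ] H) (p : ℝ) : 0 ≤ T ^ p := CFC.rpow_nonneg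

/-- Jensen's inequality for a vector state: apply the functional calculus to the tangent line of
`t ↦ t ^ p` at `⟨ξ, T ξ⟩`. -/
theorem quad_rpow_le {p : ℝ} (hp : 1 ≤ p) {T : H →L[ℂ] H} (hT : 0 ≤ T) {ξ : H} (hξ : ‖ξ‖ = 1) :
    quad T ξ ^ p ≤ quad (T ^ p) ξ := by
  set m := (inner ℂ ξ (T ξ)).re with hm
  have hm0 : 0 ≤ m := re_inner_nonneg hT ξ
  rw [quad, ENNReal.ofReal_rpow_of_nonneg hm0 (by linarith)]
  refine ENNReal.ofReal_le_ofReal ?_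
  have hsa : IsSelfAdjoint T := hT.isSelfAdjoint
  have key : cfc (fun t : ℝ => m ^ p + p * m ^ (p - 1) * (t - m)) T ≤ T ^ p := by
    rw [CFC.rpow_eq_cfc_real hT]
    refine cfc_mono (fun t ht => ?_) (by fun_prop)
      (fun t _ => (Real.continuousAt_rpow_const t p (Or.inr (by linarith))).continuousWithinAt)
    have ht0 : 0 ≤ t := spectrum_nonneg_of_nonneg hT ht
    -- for `m > 0` the tangent line inequality is Bernoulli's inequality at `t / m - 1`
    rcases hm0.eq_or_lt with h0 | h0
    · rw [← h0, Real.zero_rpow (by linarith)]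
      rcases hp.eq_or_lt with h1 | h1
      · simp [← h1]
      · rw [Real.zero_rpow (by linarith)]
        simpa using Real.rpow_nonneg ht0 p
    · have hb := one_add_mul_self_le_rpow_one_add (s := t / m - 1)
        (by have := div_nonneg ht0 hm0; linarith) hp
      rw [add_sub_cancel, Real.div_rpow ht0 hm0, le_div_iff₀ (Real.rpow_pos_of_pos h0 p)] at hb
      refine le_trans (le_of_eq ?_) hb
      rw [Real.rpow_sub_one h0.ne']
      field_simp
  have h2 := re_inner_mono key ξ
  have h3 : cfc (fun t : ℝ => m ^ p + p * m ^ (p - 1) * (t - m)) T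
      = algebraMap ℝ _ (m ^ p - p * m ^ (p - 1) * m) + (p * m ^ (p - 1)) • T := by
    rw [← cfc_id' ℝ T, ← cfc_smul .., ← cfc_const_add .., cfc_id' ℝ T]
    congr 1
    ext t
    simp only [smul_eq_mul]
    ring
  rw [h3] at h2
  refine le_trans (le_of_eq ?_) h2
  rw [Algebra.algebraMap_eq_smul_one]
  simp [inner_smul_right_eq_smul, inner_self_eq_norm_sq_to_K, hξ, ← hm]

/-- `T ^ p` acts on an eigenvector of `T` as multiplication by the power of the eigenvalue: divide
`t ^ p - r ^ p` by `t - r`. -/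
theorem rpow_apply_of_eigenvector {p : ℝ} (hp : 1 ≤ p) {T : H →L[ℂ] H} (hT : 0 ≤ T) {ξ : H} {r : ℝ}
    (h : T ξ = r • ξ) : (T ^ p) ξ = (r ^ p) • ξ := by
  have hsa : IsSelfAdjoint T := hT.isSelfAdjoint
  have hd : Differentiable ℝ (fun t : ℝ => t ^ p) := fun t =>
    (Real.hasDerivAt_rpow_const (Or.inr hp)).differentiableAt
  have hc : Continuous (dslope (fun t : ℝ => t ^ p) r) := by
    rw [← continuousOn_univ, continuousOn_dslope Filter.univ_mem]
    exact ⟨hd.continuous.continuousOn, hd r⟩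
  have key : T ^ p = cfc (dslope (fun t : ℝ => t ^ p) r) T * (T - algebraMap ℝ _ r)
      + algebraMap ℝ _ (r ^ p) := by
    have h1 : T - algebraMap ℝ _ r = cfc (fun t : ℝ => t - r) T := by
      rw [cfc_sub .., cfc_id' ℝ T, cfc_const ..]
    rw [h1, ← cfc_mul _ _ T hc.continuousOn (by fun_prop), ← cfc_add_const _ _ _ (by fun_prop),
      CFC.rpow_eq_cfc_real hT]
    refine cfc_congr fun t _ => ?_
    have := sub_smul_dslope (fun t : ℝ => t ^ p) r t
    simp only [smul_eq_mul] at this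
    rw [mul_comm, this]
    ring
  rw [key]
  simp [Algebra.algebraMap_eq_smul_one, h]

theorem quad_rpow_of_eigenvector {p : ℝ} (hp : 1 ≤ p) {T : H →L[ℂ] H} (hT : 0 ≤ T) {ξ : H} {μ : ℂ}
    (hξ : ‖ξ‖ = 1) (h : T ξ = μ • ξ) : quad (T ^ p) ξ = quad T ξ ^ p := by
  have hμ : inner ℂ ξ (T ξ) = μ := by
    simp [h, inner_self_eq_norm_sq_to_K, hξ]
  obtain ⟨r, rfl⟩ : ∃ r : ℝ, μ = r := ⟨_, hμ.symm.trans (inner_eq_re hT ξ)⟩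
  have hr : 0 ≤ r := by simpa [hμ] using re_inner_nonneg hT ξ
  have h2 := rpow_apply_of_eigenvector hp hT (r := r) (ξ := ξ) (by simpa using h)
  rw [quad, quad, hμ, h2, Complex.ofReal_re, ENNReal.ofReal_rpow_of_nonneg hr (by linarith)]
  simp [inner_smul_right_eq_smul, inner_self_eq_norm_sq_to_K, hξ]

end

/-! ### Compactness and diagonalization -/

section

variable {H : Type u} [NormedAddCommGroup H] [InnerProductSpace ℂ H]

/-- A bound between diagonal values at unit vectors extends to the unit ball, because the left side
is homogeneous of the larger degree `2 * p`. -/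
theorem quad_rpow_le_of_unit {p : ℝ} (hp : 1 < p) {B S : H →L[ℂ] H} {C : ℝ≥0∞}
    (h : ∀ ξ : H, ‖ξ‖ = 1 → quad B ξ ^ p ≤ C * quad S ξ) {ξ : H} (hξ : ‖ξ‖ ≤ 1) :
    quad B ξ ^ p ≤ C * quad S ξ := by
  rcases eq_or_ne ξ 0 with rfl | h0
  · simp [quad, (zero_lt_one.trans hp)]
  have hn : 0 < ‖ξ‖ := norm_pos_iff.2 h0
  have hs := norm_smul_normalized ξ
  have h1 := h _ (norm_normalized h0)
  rw [← hs, quad_smul_vec B, quad_smul_vec S, ENNReal.mul_rpow_of_nonneg _ _ (by linarith),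
    mul_left_comm]
  gcongr
  rw [ENNReal.ofReal_rpow_of_nonneg (by positivity) (by linarith)]
  refine ENNReal.ofReal_le_ofReal ?_
  have := Real.rpow_le_rpow_of_exponent_ge (x := ‖ξ‖ ^ 2) (by positivity)
    (pow_le_one₀ hn.le hξ) hp.le
  simpa using this

variable [CompleteSpace H]

/-- A positive operator whose diagonal values are dominated by those of a trace class operator is
compact: its square root is the norm limit of its restrictions to the spans of finitely many basis
vectors. -/
theorem isCompactOperator_of_quad_le {ι : Type*} (b : HilbertBasis ι ℂ H) {p : ℝ} (hp : 1 < p)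
    {B S : H →L[ℂ] H} (hB : 0 ≤ B) (hS : 0 ≤ S) {C : ℝ≥0∞} (hC : C ≠ ∞)
    (hS' : ∑' i, quad S (b i) ≠ ∞)
    (h : ∀ ξ : H, ‖ξ‖ = 1 → quad B ξ ^ p ≤ C * quad S ξ) : IsCompactOperator B := by
  classical
  have hp0 : 0 < p := by linarith
  suffices hR : IsCompactOperator (CFC.sqrt B : H →L[ℂ] H) by
    have := hR.clm_comp (CFC.sqrt B)
    have h2 : B = CFC.sqrt B ∘L CFC.sqrt B := (CFC.sqrt_mul_sqrt_self B hB).symm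
    rw [h2]
    exact this
  let K : Finset ι → Submodule ℂ H := fun s => Submodule.span ℂ (b '' (s : Set ι))
  have hK : ∀ s, FiniteDimensional ℂ (K s) := fun s =>
    FiniteDimensional.span_of_finite ℂ (s.finite_toSet.image b)
  -- the compression of `S` to the complement of `K s` has small trace
  have hquad : ∀ (s : Finset ι) (ξ : H), quad S ((K s)ᗮ.starProjection ξ)
      ≤ ENNReal.ofReal (‖ξ‖ ^ 2) * ∑' i : {i // i ∉ s}, quad S (b i) := by
    intro s ξ
    set Q := (K s)ᗮ.starProjection with hQ
    have hQS : 0 ≤ Q ∘L S ∘L Q := by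
      rw [ContinuousLinearMap.nonneg_iff_isPositive] at hS ⊢
      exact hS.conj_starProjection _
    have hq : ∀ η, quad (Q ∘L S ∘L Q) η = quad S (Q η) := by
      intro η
      rw [quad, quad]
      congr 2
      exact ((K s)ᗮ.inner_starProjection_left_eq_right η _).symm
    rw [← hq]
    refine (quad_le_tsum b hQS ξ).trans (mul_le_mul_right ?_ _)
    simp_rw [hq]
    refine le_of_le_of_eq ?_ (tsum_subtype {i | i ∉ s} (fun i => quad S (b i))).symm
    refine ENNReal.tsum_le_tsum fun i => ?_
    by_cases hi : i ∈ s
    · have : Q (b i) = 0 := by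
        rw [hQ, Submodule.starProjection_apply_eq_zero_iff]
        exact Submodule.le_orthogonal_orthogonal _
          (Submodule.subset_span (mem_image_of_mem _ hi))
      simp [this, quad]
    · have : Q (b i) = b i := by
        rw [hQ, Submodule.starProjection_eq_self_iff]
        rw [Submodule.mem_orthogonal]
        intro u hu
        refine Submodule.span_induction (p := fun u _ => inner ℂ u (b i) = 0) ?_ (by simp)
          (fun _ _ _ _ hx hy => by rw [inner_add_left, hx, hy, add_zero])
          (fun _ _ _ hx => by rw [inner_smul_left, hx, mul_zero]) hu
        rintro _ ⟨j, hj, rfl⟩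
        exact b.orthonormal.2 (by rintro rfl; exact hi hj)
      rw [this, indicator_of_mem (by exact hi)]
  have htail := ENNReal.tendsto_tsum_compl_atTop_zero hS'
  have hmem : CFC.sqrt B ∈ closure {f : H →L[ℂ] H | IsCompactOperator f} := by
    rw [Metric.mem_closure_iff]
    intro ε hε
    have hlim : Filter.Tendsto (fun s : Finset ι => C * ∑' i : {i // i ∉ s}, quad S (b i))
        Filter.atTop (nhds 0) := by
      simpa using ENNReal.Tendsto.const_mul htail (Or.inr hC)
    -- the diagonal values of `B` are squares of norms of values of `CFC.sqrt B`
    have hpos : 0 < ENNReal.ofReal (((ε / 2) ^ 2) ^ p) := by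
      rw [ENNReal.ofReal_pos]; positivity
    obtain ⟨s, hs⟩ := (hlim.eventually (gt_mem_nhds hpos)).exists
    refine ⟨CFC.sqrt B ∘L (K s).starProjection, ?_, ?_⟩
    · have hc : IsCompactOperator (K s).starProjection := by
        have : IsCompactOperator ((K s).subtypeL) := by
          have := FiniteDimensional.proper ℂ (K s)
          exact isCompactOperator_of_locallyCompactSpace_rng _
        exact this.comp_clm (K s).orthogonalProjectionOnto
      exact hc.clm_comp _
    · rw [dist_eq_norm]
      refine lt_of_le_of_lt (ContinuousLinearMap.opNorm_le_of_unit_norm (C := ε / 2) (by positivity)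
        fun ξ hξ => ?_) (half_lt_self hε)
      have hdec : (CFC.sqrt B - CFC.sqrt B ∘L (K s).starProjection) ξ
          = CFC.sqrt B ((K s)ᗮ.starProjection ξ) := by
        rw [Submodule.starProjection_orthogonal_val]
        simp
      rw [hdec]
      have hn : ‖(K s)ᗮ.starProjection ξ‖ ≤ 1 := by
        rw [← hξ]
        exact Submodule.norm_starProjection_apply_le _ ξ
      have h1 := (quad_rpow_le_of_unit hp h hn).trans (mul_le_mul_right (hquad s ξ) C)
      rw [hξ, one_pow, ENNReal.ofReal_one, one_mul] at h1
      have h2 := h1.trans hs.le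
      rw [quad_eq_norm_sqrt hB, ENNReal.ofReal_rpow_of_nonneg (by positivity) hp0.le,
        ENNReal.ofReal_le_ofReal_iff (by positivity)] at h2
      rw [Real.rpow_le_rpow_iff (by positivity) (by positivity) hp0] at h2
      exact (sq_le_sq₀ (norm_nonneg _) (by positivity)).1 h2
  exact isClosed_setOfPred_isCompactOperator.closure_subset hmem

/-- Bases of pairwise orthogonal closed subspaces with dense sum make up a basis of the space. -/
theorem exists_hilbertBasis_of_orthogonalFamily {κ : Type} {V : κ → Submodule ℂ H}
    (hV : OrthogonalFamily ℂ (fun k => V k) fun k => (V k).subtypeₗᵢ)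
    (hclosed : ∀ k, IsClosed (V k : Set H)) (hbot : (⨆ k, V k)ᗮ = ⊥) :
    ∃ (ι : Type u) (b : HilbertBasis ι ℂ H), ∀ i, ∃ k, b i ∈ V k := by
  have : ∀ k, CompleteSpace (V k) := fun k => (hclosed k).completeSpace_coe
  choose w c _ using fun k => exists_hilbertBasis ℂ (V k)
  let v : (Σ k, w k) → H := fun a => (c a.1 a.2 : H)
  have hv : Orthonormal ℂ v := hV.orthonormal_sigma_orthonormal fun k => (c k).orthonormal
  have hspan : (Submodule.span ℂ (range v))ᗮ = ⊥ := by
    rw [eq_bot_iff, ← hbot, Submodule.iSup_eq_span]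
    intro x hx
    rw [Submodule.mem_orthogonal] at hx ⊢
    intro u hu
    refine Submodule.span_induction (p := fun u _ => inner ℂ u x = 0) ?_ (by simp)
      (fun _ _ _ _ hx hy => by rw [inner_add_left, hx, hy, add_zero])
      (fun _ _ _ hx => by rw [inner_smul_left, hx, mul_zero]) hu
    intro y hy
    obtain ⟨k, hy⟩ := mem_iUnion.1 hy
    have h1 := ((c k).hasSum_repr ⟨y, hy⟩).mapL (V k).subtypeL
    have h2 := h1.mapL (innerSL ℂ x)
    have h3 : inner ℂ x y = 0 := by
      refine h2.unique ?_
      convert hasSum_zero with i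
      have := hx _ (Submodule.subset_span (mem_range_self (⟨k, i⟩ : Σ k, w k)))
      rw [inner_eq_zero_symm] at this
      simpa using Or.inr this
    exact inner_eq_zero_symm.1 h3
  refine ⟨_, HilbertBasis.mkOfOrthogonalEqBot hv hspan, fun a => ⟨a.1, ?_⟩⟩
  rw [HilbertBasis.coe_mkOfOrthogonalEqBot]
  exact (c a.1 a.2).2

/-- A compact positive operator is diagonal in some orthonormal basis. -/
theorem exists_hilbertBasis_eigenvectors {B : H →L[ℂ] H} (hB : 0 ≤ B) (hc : IsCompactOperator B) :
    ∃ (ι : Type u) (b : HilbertBasis ι ℂ H), ∀ i, ∃ μ : ℂ, B (b i) = μ • b i := by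
  have hsym : (B : H →ₗ[ℂ] H).IsSymmetric :=
    ((ContinuousLinearMap.nonneg_iff_isPositive B).1 hB).isSymmetric
  have hclosed : ∀ μ, IsClosed (Module.End.eigenspace (B : H →ₗ[ℂ] H) μ : Set H) := by
    intro μ
    have : (Module.End.eigenspace (B : H →ₗ[ℂ] H) μ : Set H) = {x | B x = μ • x} := by
      ext x
      exact Module.End.mem_eigenspace_iff
    rw [this]
    exact isClosed_eq B.continuous (continuous_const_smul μ)
  obtain ⟨ι, b, hb⟩ := exists_hilbertBasis_of_orthogonalFamily hsym.orthogonalFamily_eigenspaces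
    hclosed (ContinuousLinearMap.orthogonalComplement_iSup_eigenspaces_eq_bot hc hsym)
  exact ⟨ι, b, fun i => (hb i).imp fun μ h => Module.End.mem_eigenspace_iff.1 h⟩

/-- The trace of `B ^ p` is bounded by any trace whose diagonal values
dominate the `p`-th powers of those of `B`; evaluate both traces in an eigenbasis of `B`. -/
theorem tsum_quad_rpow_le {ι : Type*} (b : HilbertBasis ι ℂ H) {p : ℝ} (hp : 1 < p)
    {B S : H →L[ℂ] H} (hB : 0 ≤ B) (hS : 0 ≤ S) {C : ℝ≥0∞} (hC : C ≠ ∞)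
    (hS' : ∑' i, quad S (b i) ≠ ∞)
    (h : ∀ ξ : H, ‖ξ‖ = 1 → quad B ξ ^ p ≤ C * quad S ξ) :
    ∑' i, quad (B ^ p) (b i) ≤ C * ∑' i, quad S (b i) := by
  obtain ⟨κ, c, hc⟩ := exists_hilbertBasis_eigenvectors hB
    (isCompactOperator_of_quad_le b hp hB hS hC hS' h)
  rw [tsum_quad_eq b c (opRpow_nonneg B p), tsum_quad_eq b c hS, ← ENNReal.tsum_mul_left]
  refine ENNReal.tsum_le_tsum fun i => ?_
  obtain ⟨μ, hμ⟩ := hc i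
  rw [quad_rpow_of_eigenvector hp.le hB (c.orthonormal.1 i) hμ]
  exact h _ (c.orthonormal.1 i)

/-! ### Trace class -/

theorem isTraceClass_iff {T : H →L[ℂ] H} (hT : 0 ≤ T) :
    IsTraceClass T ↔ ∀ (w : Set H) (b : HilbertBasis w ℂ H), ∑' i, quad T (b i) ≠ ∞ := by
  unfold IsTraceClass
  rw [CFC.abs_of_nonneg T hT]
  refine forall₂_congr fun w b => ⟨fun h => h.tsum_ofReal_ne_top, fun h => ?_⟩
  have := ENNReal.summable_toReal h
  refine this.congr fun i => ?_
  rw [quad, ENNReal.toReal_ofReal (re_inner_nonneg hT _)]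

theorem re_trace_eq {T : H →L[ℂ] H} (hT : 0 ≤ T) :
    (trace T).re = (∑' i, quad T (onb H i)).toReal := by
  have h1 : ∀ i, inner ℂ (onb H i) (T (onb H i)) = (((quad T (onb H i)).toReal : ℝ) : ℂ) := by
    intro i
    rw [quad, ENNReal.toReal_ofReal (re_inner_nonneg hT _)]
    exact inner_eq_re hT _
  rw [trace, tsum_congr h1, ← Complex.ofReal_tsum, Complex.ofReal_re,
    ENNReal.tsum_toReal_eq]
  exact fun i => ENNReal.ofReal_ne_top

end

/-! ### Weak integrals of positive operators -/

section

variable {H : Type u} [NormedAddCommGroup H] [InnerProductSpace ℂ H]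

theorem WeaklyMeasurableOn.mono {F : ℝ → H →L[ℂ] H} {s t : Set ℝ} (h : WeaklyMeasurableOn F t)
    (hst : s ⊆ t) : WeaklyMeasurableOn F s :=
  fun ξ η => (h ξ η).mono_measure (Measure.restrict_mono hst le_rfl)

theorem WeaklyMeasurableOn.quad {F : ℝ → H →L[ℂ] H} {s : Set ℝ} (h : WeaklyMeasurableOn F s)
    (ξ : H) : AEMeasurable (fun x => quad (F x) ξ) (volume.restrict s) :=
  (Complex.measurable_re.comp_aemeasurable (h ξ ξ)).ennreal_ofReal

theorem HasWeakIntegral.quad_eq {F : ℝ → H →L[ℂ] H} {s : Set ℝ} (hs : MeasurableSet s)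
    (hF : ∀ x ∈ s, 0 ≤ F x) {T : H →L[ℂ] H} (h : HasWeakIntegral F s T) (ξ : H) :
    TracialHardy.quad T ξ = ∫⁻ x in s, TracialHardy.quad (F x) ξ := by
  obtain ⟨hi, he⟩ := h ξ ξ
  have h1 : (inner ℂ ξ (T ξ)).re = ∫ x in s, (inner ℂ ξ (F x ξ)).re := by
    rw [← he]
    exact (integral_re hi).symm
  rw [TracialHardy.quad, h1]
  refine ofReal_integral_eq_lintegral_ofReal hi.re ?_
  exact (ae_restrict_iff' hs).2 (.of_forall fun x hx => re_inner_nonneg (hF x hx) ξ)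

theorem HasWeakIntegral.nonneg {F : ℝ → H →L[ℂ] H} {s : Set ℝ} (hs : MeasurableSet s)
    (hF : ∀ x ∈ s, 0 ≤ F x) {T : H →L[ℂ] H} (h : HasWeakIntegral F s T) : 0 ≤ T := by
  refine nonneg_of_inner fun ξ => ⟨∫ x in s, (inner ℂ ξ (F x ξ)).re,
    setIntegral_nonneg hs fun x hx => re_inner_nonneg (hF x hx) ξ, ?_⟩
  rw [← (h ξ ξ).2]
  exact (setIntegral_congr_fun hs fun x hx => inner_eq_re (hF x hx) ξ).trans integral_ofReal

variable [CompleteSpace H]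

/-- The Cauchy-Schwarz inequality for the form of `T`, followed by the inequality of means with its
factor `1 / 2` dropped; a linear bound is what can be integrated. -/
theorem enorm_inner_le_quad_add_quad {T : H →L[ℂ] H} (hT : 0 ≤ T) (ξ η : H) :
    ‖inner ℂ ξ (T η)‖ₑ ≤ quad T ξ + quad T η := by
  have h : T η = CFC.sqrt T (CFC.sqrt T η) := by
    conv_lhs => rw [← CFC.sqrt_mul_sqrt_self T hT]
    rfl
  rw [quad_eq_norm_sqrt hT, quad_eq_norm_sqrt hT, ← ENNReal.ofReal_add (by positivity)
    (by positivity), h, ← inner_sqrt_left, ← ofReal_norm]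
  refine ENNReal.ofReal_le_ofReal ((norm_inner_le_norm _ _).trans ?_)
  nlinarith [sq_nonneg (‖CFC.sqrt T ξ‖ - ‖CFC.sqrt T η‖), sq_nonneg ‖CFC.sqrt T ξ‖,
    sq_nonneg ‖CFC.sqrt T η‖]

/-- A weakly measurable family of positive operators with bounded integrated quadratic form has a
bounded weak integral, namely the operator of the integrated sesquilinear form. -/
theorem weaklyIntegrableOn_of_lintegral_quad_le {F : ℝ → H →L[ℂ] H} {s : Set ℝ}
    (hs : MeasurableSet s) (hF : ∀ x ∈ s, 0 ≤ F x) (hm : WeaklyMeasurableOn F s) {M : ℝ≥0∞}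
    (hM : M ≠ ∞) (h : ∀ ξ : H, ‖ξ‖ = 1 → ∫⁻ x in s, quad (F x) ξ ≤ M) :
    WeaklyIntegrableOn F s := by
  have hbound : ∀ ξ η : H, ∫⁻ x in s, ‖inner ℂ ξ (F x η)‖ₑ
      ≤ (∫⁻ x in s, quad (F x) ξ) + ∫⁻ x in s, quad (F x) η := by
    intro ξ η
    rw [← lintegral_add_left' (hm.quad ξ)]
    exact setLIntegral_mono' hs fun x hx => enorm_inner_le_quad_add_quad (hF x hx) ξ η
  have hfin : ∀ ξ : H, ∫⁻ x in s, quad (F x) ξ ≠ ∞ := by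
    intro ξ
    rcases eq_or_ne ξ 0 with rfl | h0
    · simp [quad]
    · rw [← norm_smul_normalized ξ]
      simp_rw [quad_smul_vec _ (((‖ξ‖⁻¹ : ℝ) : ℂ) • ξ)]
      rw [lintegral_const_mul' _ _ ENNReal.ofReal_ne_top]
      exact ENNReal.mul_ne_top ENNReal.ofReal_ne_top
        ((h _ (norm_normalized h0)).trans_lt hM.lt_top).ne
  have hint : ∀ ξ η : H, IntegrableOn (fun x => inner ℂ ξ (F x η)) s volume := fun ξ η =>
    ⟨(hm ξ η).aestronglyMeasurable,
      (hbound ξ η).trans_lt (ENNReal.add_lt_top.2 ⟨(hfin ξ).lt_top, (hfin η).lt_top⟩)⟩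
  let Φ : H →ₗ⋆[ℂ] H →ₗ[ℂ] ℂ := LinearMap.mk₂'ₛₗ (starRingEnd ℂ) (RingHom.id ℂ)
    (fun ξ η => ∫ x in s, inner ℂ ξ (F x η))
    (fun ξ₁ ξ₂ η => by
      simp_rw [inner_add_left]
      exact integral_add (hint _ _) (hint _ _))
    (fun c ξ η => by
      simp_rw [inner_smul_left]
      exact integral_const_mul _ _)
    (fun ξ η₁ η₂ => by
      simp_rw [map_add, inner_add_right]
      exact integral_add (hint _ _) (hint _ _))
    (fun c ξ η => by
      simp_rw [map_smul, inner_smul_right]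
      exact integral_const_mul _ _)
  have hΦunit : ∀ ξ η : H, ‖ξ‖ = 1 → ‖η‖ = 1 → ‖Φ ξ η‖ ≤ (M + M).toReal := by
    intro ξ η hξ hη
    rw [← ENNReal.ofReal_le_iff_le_toReal (ENNReal.add_ne_top.2 ⟨hM, hM⟩), ofReal_norm]
    exact (enorm_integral_le_lintegral_enorm _).trans
      ((hbound ξ η).trans (add_le_add (h ξ hξ) (h η hη)))
  have hΦ : ∀ ξ η : H, ‖Φ ξ η‖ ≤ (M + M).toReal * ‖ξ‖ * ‖η‖ := by
    intro ξ η
    rcases eq_or_ne ξ 0 with rfl | hξ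
    · simp
    rcases eq_or_ne η 0 with rfl | hη
    · simp
    have h1 := hΦunit _ _ (norm_normalized hξ) (norm_normalized hη)
    calc ‖Φ ξ η‖
        = ‖Φ (((‖ξ‖ : ℝ) : ℂ) • (((‖ξ‖⁻¹ : ℝ) : ℂ) • ξ))
            (((‖η‖ : ℝ) : ℂ) • (((‖η‖⁻¹ : ℝ) : ℂ) • η))‖ := by
          rw [norm_smul_normalized, norm_smul_normalized]
      _ = ‖Φ (((‖ξ‖⁻¹ : ℝ) : ℂ) • ξ) (((‖η‖⁻¹ : ℝ) : ℂ) • η)‖ * ‖ξ‖ * ‖η‖ := by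
          rw [LinearMap.map_smulₛₗ₂, LinearMap.map_smul (Φ _)]
          simp only [smul_eq_mul, norm_mul, Complex.conj_ofReal, Complex.norm_real, norm_norm]
          ring
      _ ≤ _ := by gcongr
  refine ⟨ContinuousLinearMap.adjoint
    (InnerProductSpace.continuousLinearMapOfBilin (𝕜 := ℂ) (Φ.mkContinuous₂ _ hΦ)),
    fun ξ η => ⟨hint ξ η, ?_⟩⟩
  rw [ContinuousLinearMap.adjoint_inner_right,
    InnerProductSpace.continuousLinearMapOfBilin_apply]
  rfl

end

/-! ### Scalar inequalities -/

/-- Hölder's inequality with a weight `u`. -/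
theorem lintegral_rpow_le_mul {α : Type*} [MeasurableSpace α] {μ : Measure α} {p q : ℝ}
    (hpq : p.HolderConjugate q) {h u : α → ℝ≥0∞} (hh : AEMeasurable h μ) (hu : AEMeasurable u μ)
    (hu0 : ∀ᵐ x ∂μ, u x ≠ 0 ∧ u x ≠ ∞) :
    (∫⁻ x, h x ∂μ) ^ p ≤ (∫⁻ x, (u x)⁻¹ ^ q ∂μ) ^ (p - 1) * ∫⁻ x, u x ^ p * h x ^ p ∂μ := by
  have h1 := ENNReal.lintegral_mul_le_Lp_mul_Lq μ hpq (hu.mul hh) hu.inv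
  have h2 : ∫⁻ x, ((u * h) * fun x => (u x)⁻¹) x ∂μ = ∫⁻ x, h x ∂μ := by
    refine lintegral_congr_ae (hu0.mono fun x hx => ?_)
    simp only [Pi.mul_apply]
    rw [mul_comm, ← mul_assoc, ENNReal.inv_mul_cancel hx.1 hx.2, one_mul]
  rw [← h2]
  refine (ENNReal.rpow_le_rpow h1 hpq.nonneg).trans (le_of_eq ?_)
  rw [ENNReal.mul_rpow_of_nonneg _ _ hpq.nonneg, ← ENNReal.rpow_mul, ← ENNReal.rpow_mul,
    one_div_mul_cancel hpq.ne_zero, ENNReal.rpow_one, mul_comm, one_div, inv_mul_eq_div,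
    hpq.div_conj_eq_sub_one]
  simp_rw [Pi.mul_apply, Pi.inv_apply, ENNReal.mul_rpow_of_nonneg _ _ hpq.nonneg]

theorem lintegral_rpow_le_measure_mul {α : Type*} [MeasurableSpace α] {μ : Measure α} {p : ℝ}
    (hp : 1 < p) {h : α → ℝ≥0∞} (hh : AEMeasurable h μ) :
    (∫⁻ x, h x ∂μ) ^ p ≤ μ univ ^ (p - 1) * ∫⁻ x, h x ^ p ∂μ := by
  simpa using lintegral_rpow_le_mul (Real.HolderConjugate.conjExponent hp) hh
    (u := fun _ => 1) aemeasurable_const (by simp)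

/-- Hölder's inequality on `(0, x]` with the weight `t ^ (1 / q)` that makes Hardy's inequality
sharp. -/
theorem lintegral_Ioc_rpow_le {p q : ℝ} (hpq : p.HolderConjugate q) {x : ℝ} (hx : 0 < x)
    {h : ℝ → ℝ≥0∞} (hh : AEMeasurable h (volume.restrict (Ioc 0 x))) :
    (∫⁻ t in Ioc 0 x, h t) ^ p ≤ ENNReal.ofReal ((q * x ^ q⁻¹) ^ (p - 1)) *
      ∫⁻ t in Ioc 0 x, ENNReal.ofReal (t ^ q⁻¹) * h t ^ p := by
  have hp := hpq.lt
  have hp0 := hpq.pos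
  have hq0 := hpq.symm.pos
  have hmeas : Measurable fun t : ℝ => ENNReal.ofReal (t ^ (p * q)⁻¹) := by fun_prop
  have h1 := lintegral_rpow_le_mul hpq hh (u := fun t => ENNReal.ofReal (t ^ (p * q)⁻¹))
    hmeas.aemeasurable ((ae_restrict_iff' measurableSet_Ioc).2 (.of_forall fun t ht =>
      ⟨(ENNReal.ofReal_pos.2 (Real.rpow_pos_of_pos ht.1 _)).ne', ENNReal.ofReal_ne_top⟩))
  refine h1.trans (le_of_eq ?_)
  congr 1
  · have e1 : ∫⁻ t in Ioc 0 x, (ENNReal.ofReal (t ^ (p * q)⁻¹))⁻¹ ^ q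
        = ∫⁻ t in Ioc 0 x, ENNReal.ofReal (t ^ (-p⁻¹)) := by
      refine setLIntegral_congr_fun measurableSet_Ioc fun t ht => ?_
      rw [← ENNReal.ofReal_inv_of_pos (Real.rpow_pos_of_pos ht.1 _), ← Real.rpow_neg ht.1.le,
        ENNReal.ofReal_rpow_of_pos (Real.rpow_pos_of_pos ht.1 _), ← Real.rpow_mul ht.1.le]
      congr 2
      field_simp
    have hlt : -1 < -p⁻¹ := neg_lt_neg (inv_lt_one_of_one_lt₀ hp)
    have hi : IntegrableOn (fun t : ℝ => t ^ (-p⁻¹)) (Ioc 0 x) :=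
      (intervalIntegrable_iff_integrableOn_Ioc_of_le hx.le).1
        (intervalIntegral.intervalIntegrable_rpow' hlt)
    rw [e1, ← ofReal_integral_eq_lintegral_ofReal hi ((ae_restrict_iff' measurableSet_Ioc).2
      (.of_forall fun t ht => Real.rpow_nonneg ht.1.le _)),
      ← intervalIntegral.integral_of_le hx.le, integral_rpow (Or.inl hlt),
      ← hpq.one_sub_inv, ENNReal.ofReal_rpow_of_nonneg]
    · have : -p⁻¹ + 1 = q⁻¹ := by rw [← hpq.one_sub_inv]; ring
      rw [this, Real.zero_rpow (inv_ne_zero hq0.ne'), hpq.one_sub_inv]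
      congr 2
      field_simp
      ring
    · rw [Real.zero_rpow (by linarith)]
      have := Real.rpow_nonneg hx.le (-p⁻¹ + 1)
      apply div_nonneg <;> linarith
    · linarith
  · refine setLIntegral_congr_fun measurableSet_Ioc fun t ht => ?_
    rw [ENNReal.ofReal_rpow_of_pos (Real.rpow_pos_of_pos ht.1 _), ← Real.rpow_mul ht.1.le]
    congr 3
    field_simp

/-- The weight in the bound for `((1 / x) ∫₀ˣ h) ^ p`: the factor `x ^ (-p)` of the average times
the constant of Hölder's inequality on `(0, x]` (`lintegral_Ioc_rpow_le`). -/
def hardyKernel (p q x : ℝ) : ℝ := (x⁻¹) ^ p * (q * x ^ q⁻¹) ^ (p - 1)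

theorem hardyKernel_eq {p q x : ℝ} (hpq : p.HolderConjugate q) (hx : 0 < x) :
    hardyKernel p q x = q ^ (p - 1) * x ^ (-1 - q⁻¹) := by
  have hq0 := hpq.symm.pos
  rw [hardyKernel, Real.mul_rpow hq0.le (by positivity), ← Real.rpow_mul hx.le,
    Real.inv_rpow hx.le, ← Real.rpow_neg hx.le, mul_left_comm, ← Real.rpow_add hx]
  congr 2
  have h1 : q⁻¹ = 1 - p⁻¹ := hpq.one_sub_inv.symm
  have := hpq.ne_zero
  rw [h1]
  field_simp
  ring

theorem lintegral_Ioi_hardyKernel {p q t : ℝ} (hpq : p.HolderConjugate q) (ht : 0 < t) :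
    ∫⁻ x in Ioi t, ENNReal.ofReal (hardyKernel p q x) = ENNReal.ofReal (q ^ p * t ^ (-q⁻¹)) := by
  have hq0 := hpq.symm.pos
  have hlt : -1 - q⁻¹ < -1 := by have := inv_pos.2 hq0; linarith
  have e1 : ∫⁻ x in Ioi t, ENNReal.ofReal (hardyKernel p q x)
      = ∫⁻ x in Ioi t, ENNReal.ofReal (q ^ (p - 1) * x ^ (-1 - q⁻¹)) :=
    setLIntegral_congr_fun measurableSet_Ioi fun x hx => by
      simp only [hardyKernel_eq hpq (ht.trans hx)]
  rw [e1, ← ofReal_integral_eq_lintegral_ofReal ((integrableOn_Ioi_rpow_of_lt hlt ht).const_mul _)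
    ((ae_restrict_iff' measurableSet_Ioi).2 (.of_forall fun x hx =>
      mul_nonneg (by positivity) (Real.rpow_nonneg (ht.trans hx).le _))),
    integral_const_mul, integral_Ioi_rpow_of_lt hlt ht]
  congr 1
  rw [Real.rpow_sub_one hq0.ne', show -1 - q⁻¹ + 1 = -q⁻¹ by ring]
  field_simp

/-- Tonelli's theorem on `{(x, t) | 0 < t ≤ x}`: the integral of the kernel over `x ≥ t` cancels the
weight `t ^ (1 / q)` and leaves the constant `q ^ p`. -/
theorem lintegral_hardyKernel_mul {p q : ℝ} (hpq : p.HolderConjugate q) {φ : ℝ → ℝ≥0∞}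
    (hφ : AEMeasurable φ (volume.restrict (Ioi 0))) :
    ∫⁻ x in Ioi 0, ENNReal.ofReal (hardyKernel p q x) *
        ∫⁻ t in Ioc 0 x, ENNReal.ofReal (t ^ q⁻¹) * φ t
      = ENNReal.ofReal (q ^ p) * ∫⁻ t in Ioi 0, φ t := by
  have hq0 := hpq.symm.pos
  obtain ⟨ψ, hψ, hae⟩ := hφ
  have e1 : ∀ x : ℝ, ∫⁻ t in Ioc 0 x, ENNReal.ofReal (t ^ q⁻¹) * φ t
      = ∫⁻ t in Ioi 0, (Iic x).indicator (fun t => ENNReal.ofReal (t ^ q⁻¹) * ψ t) t := by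
    intro x
    rw [lintegral_indicator measurableSet_Iic, Measure.restrict_restrict measurableSet_Iic,
      inter_comm, Ioi_inter_Iic]
    refine lintegral_congr_ae ?_
    filter_upwards [ae_restrict_of_ae_restrict_of_subset Ioc_subset_Ioi_self hae] with t ht
    rw [ht]
  have hk : Measurable fun x => ENNReal.ofReal (hardyKernel p q x) := by
    unfold hardyKernel
    fun_prop
  simp_rw [e1]
  have e2 : ∀ x : ℝ, ENNReal.ofReal (hardyKernel p q x) * ∫⁻ t in Ioi 0,
        (Iic x).indicator (fun t => ENNReal.ofReal (t ^ q⁻¹) * ψ t) t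
      = ∫⁻ t in Ioi 0, (Ici t).indicator
        (fun x => ENNReal.ofReal (hardyKernel p q x) * (ENNReal.ofReal (t ^ q⁻¹) * ψ t)) x := by
    intro x
    rw [← lintegral_const_mul' _ _ ENNReal.ofReal_ne_top]
    refine lintegral_congr fun t => ?_
    by_cases h : t ≤ x
    · rw [indicator_of_mem (mem_Iic.2 h), indicator_of_mem (mem_Ici.2 h)]
    · rw [indicator_of_notMem (by simpa using h), indicator_of_notMem (by simpa using h), mul_zero]
  simp_rw [e2]
  rw [lintegral_lintegral_swap]
  · rw [← lintegral_const_mul' _ _ ENNReal.ofReal_ne_top]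
    refine lintegral_congr_ae ?_
    filter_upwards [hae, ae_restrict_mem measurableSet_Ioi] with t ht ht0
    have ht0 : 0 < t := ht0
    rw [lintegral_indicator measurableSet_Ici, Measure.restrict_restrict measurableSet_Ici,
      inter_eq_left.2 (Ici_subset_Ioi.2 ht0), lintegral_mul_const _ hk,
      setLIntegral_congr Ioi_ae_eq_Ici.symm, lintegral_Ioi_hardyKernel hpq ht0, ← ht, ← mul_assoc,
      ← ENNReal.ofReal_mul (by positivity), mul_assoc, ← Real.rpow_add ht0]
    simp
  · have hset : MeasurableSet {z : ℝ × ℝ | z.2 ≤ z.1} :=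
      measurableSet_le measurable_snd measurable_fst
    have : Measurable (fun z : ℝ × ℝ => {z : ℝ × ℝ | z.2 ≤ z.1}.indicator
        (fun z => ENNReal.ofReal (hardyKernel p q z.1) *
          (ENNReal.ofReal (z.2 ^ q⁻¹) * ψ z.2)) z) := by
      refine Measurable.indicator ?_ hset
      exact (hk.comp measurable_fst).mul (by fun_prop)
    exact this.aemeasurable

/-- One inequality of Tonelli's theorem for sums holds without countability of the index set. -/
theorem tsum_lintegral_le_lintegral_tsum {α ι : Type*} [MeasurableSpace α] {μ : Measure α}
    {φ : ι → α → ℝ≥0∞} (hφ : ∀ i, AEMeasurable (φ i) μ) :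
    ∑' i, ∫⁻ x, φ i x ∂μ ≤ ∫⁻ x, ∑' i, φ i x ∂μ := by
  rw [ENNReal.tsum_eq_iSup_sum]
  refine iSup_le fun s => ?_
  rw [← lintegral_finsetSum' s fun i _ => hφ i]
  exact lintegral_mono fun x => ENNReal.sum_le_tsum s

/-! ### The averages of an operator function -/

section

variable {H : Type u} [NormedAddCommGroup H] [InnerProductSpace ℂ H]

theorem quad_le_norm (T : H →L[ℂ] H) {ξ : H} (hξ : ‖ξ‖ = 1) : quad T ξ ≤ ENNReal.ofReal ‖T‖ := by
  refine ENNReal.ofReal_le_ofReal ((Complex.re_le_norm _).trans ((norm_inner_le_norm _ _).trans ?_))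
  simpa [hξ] using T.le_opNorm ξ

variable [CompleteSpace H]

theorem hasWeakIntegral_weakIntegral {F : ℝ → H →L[ℂ] H} {s : Set ℝ} (h : WeaklyIntegrableOn F s) :
    HasWeakIntegral F s (weakIntegral F s) := by
  obtain ⟨T, hT⟩ := h
  rwa [hT.weakIntegral_eq]

theorem norm_le_of_quad_le {T : H →L[ℂ] H} (hT : 0 ≤ T) {M : ℝ} (hM : 0 ≤ M)
    (h : ∀ ξ : H, ‖ξ‖ = 1 → quad T ξ ≤ ENNReal.ofReal M) : ‖T‖ ≤ M := by
  refine norm_le_of_re_inner_le hT hM fun ξ => ?_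
  rcases eq_or_ne ξ 0 with rfl | h0
  · simp
  have hs := norm_smul_normalized ξ
  have h1 : quad T ξ ≤ ENNReal.ofReal (M * ‖ξ‖ ^ 2) := by
    rw [← hs, quad_smul_vec, hs, mul_comm M, ENNReal.ofReal_mul (by positivity)]
    gcongr
    exact h _ (norm_normalized h0)
  exact (ENNReal.ofReal_le_ofReal_iff (by positivity)).1 h1

section Hardy

variable {p q : ℝ} {f : ℝ → H →L[ℂ] H} {T : H →L[ℂ] H}

/-- Jensen's inequality at each point and Hölder's inequality over `s`. The bound is uniform over
unit vectors, which gives existence of the weak integrals of `f` and their norm continuity. -/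
theorem lintegral_quad_rpow_le (hp : 1 < p) (hf : ∀ x, 0 < x → 0 ≤ f x)
    (hm : WeaklyMeasurableOn f (Ioi 0)) (hT : HasWeakIntegral (fun x => f x ^ p) (Ioi 0) T)
    {s : Set ℝ} (hs : MeasurableSet s) (hs0 : s ⊆ Ioi 0) {ξ : H} (hξ : ‖ξ‖ = 1) :
    (∫⁻ t in s, quad (f t) ξ) ^ p ≤ volume s ^ (p - 1) * quad T ξ := by
  refine (lintegral_rpow_le_measure_mul hp ((hm.mono hs0).quad ξ)).trans ?_
  rw [Measure.restrict_apply_univ, hT.quad_eq measurableSet_Ioi fun x _ => opRpow_nonneg _ _]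
  refine mul_le_mul_right ?_ _
  exact (setLIntegral_mono' hs fun t ht => quad_rpow_le hp.le (hf t (hs0 ht)) hξ).trans
    (lintegral_mono_set hs0)

theorem weaklyIntegrableOn_of_rpow (hp : 1 < p) (hf : ∀ x, 0 < x → 0 ≤ f x)
    (hm : WeaklyMeasurableOn f (Ioi 0)) (hT : HasWeakIntegral (fun x => f x ^ p) (Ioi 0) T)
    {s : Set ℝ} (hs : MeasurableSet s) (hs0 : s ⊆ Ioi 0) (hv : volume s ≠ ∞) :
    WeaklyIntegrableOn f s := by
  have hp0 : 0 < p := by linarith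
  refine weaklyIntegrableOn_of_lintegral_quad_le hs (fun x hx => hf x (hs0 hx)) (hm.mono hs0)
    (M := (volume s ^ (p - 1) * ENNReal.ofReal ‖T‖) ^ p⁻¹) ?_ fun ξ hξ => ?_
  · exact ENNReal.rpow_ne_top_of_nonneg (by positivity)
      (ENNReal.mul_ne_top (ENNReal.rpow_ne_top_of_nonneg (by linarith) hv) ENNReal.ofReal_ne_top)
  · rw [ENNReal.le_rpow_inv_iff hp0]
    refine (lintegral_quad_rpow_le hp hf hm hT hs hs0 hξ).trans ?_
    gcongr
    exact quad_le_norm T hξ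

theorem hasWeakIntegral_Ioc (hp : 1 < p) (hf : ∀ x, 0 < x → 0 ≤ f x)
    (hm : WeaklyMeasurableOn f (Ioi 0)) (hT : HasWeakIntegral (fun x => f x ^ p) (Ioi 0) T)
    {x y : ℝ} (hx : 0 ≤ x) : HasWeakIntegral f (Ioc x y) (weakIntegral f (Ioc x y)) :=
  hasWeakIntegral_weakIntegral (weaklyIntegrableOn_of_rpow hp hf hm hT measurableSet_Ioc
    (fun _ ht => hx.trans_lt ht.1) (by simp))

/-- The primitive of `f` is Hölder continuous in norm with exponent `(p - 1) / p`. -/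
theorem norm_weakIntegral_sub_le (hp : 1 < p) (hf : ∀ x, 0 < x → 0 ≤ f x)
    (hm : WeaklyMeasurableOn f (Ioi 0)) (hT : HasWeakIntegral (fun x => f x ^ p) (Ioi 0) T)
    {x y : ℝ} (hx : 0 < x) (hxy : x ≤ y) :
    ‖weakIntegral f (Ioc 0 y) - weakIntegral f (Ioc 0 x)‖
      ≤ ((y - x) ^ (p - 1) * ‖T‖) ^ p⁻¹ := by
  have hp0 : 0 < p := by linarith
  have hx' := hasWeakIntegral_Ioc hp hf hm hT (y := x) le_rfl
  have hy' := hasWeakIntegral_Ioc hp hf hm hT (y := y) le_rfl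
  have hxy' := hasWeakIntegral_Ioc hp hf hm hT (y := y) hx.le
  have hsub : weakIntegral f (Ioc 0 y) - weakIntegral f (Ioc 0 x) = weakIntegral f (Ioc x y) := by
    rw [sub_eq_iff_eq_add']
    refine HasWeakIntegral.unique hy' fun ξ η => ⟨(hy' ξ η).1, ?_⟩
    rw [← Ioc_union_Ioc_eq_Ioc hx.le hxy, setIntegral_union (Ioc_disjoint_Ioc_of_le le_rfl)
      measurableSet_Ioc (hx' ξ η).1 (hxy' ξ η).1, (hx' ξ η).2, (hxy' ξ η).2]
    simp
  have hsub0 : Ioc x y ⊆ Ioi 0 := fun t ht => hx.trans ht.1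
  have hyx : 0 ≤ y - x := sub_nonneg.2 hxy
  rw [hsub]
  refine norm_le_of_quad_le (hxy'.nonneg measurableSet_Ioc fun t ht => hf t (hsub0 ht))
    (by positivity) fun ξ hξ => ?_
  rw [hxy'.quad_eq measurableSet_Ioc fun t ht => hf t (hsub0 ht),
    ← ENNReal.ofReal_rpow_of_nonneg (by positivity) (by positivity), ENNReal.le_rpow_inv_iff hp0]
  refine (lintegral_quad_rpow_le hp hf hm hT measurableSet_Ioc hsub0 hξ).trans ?_
  rw [Real.volume_Ioc, ENNReal.ofReal_mul (by positivity),
    ENNReal.ofReal_rpow_of_nonneg hyx (by linarith)]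
  gcongr
  exact quad_le_norm T hξ

theorem continuousOn_hardyMean (hp : 1 < p) (hf : ∀ x, 0 < x → 0 ≤ f x)
    (hm : WeaklyMeasurableOn f (Ioi 0)) (hT : HasWeakIntegral (fun x => f x ^ p) (Ioi 0) T) :
    ContinuousOn (hardyMean f) (Ioi 0) := by
  have hp0 : 0 < p := by linarith
  refine ContinuousOn.smul (continuousOn_inv₀.mono fun x hx => (ne_of_gt hx)) ?_
  intro x hx
  refine tendsto_iff_norm_sub_tendsto_zero.2 ?_
  have hlim : Filter.Tendsto (fun y : ℝ => (|y - x| ^ (p - 1) * ‖T‖) ^ p⁻¹) (nhdsWithin x (Ioi 0))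
      (nhds 0) := by
    have hc : Continuous fun y : ℝ => (|y - x| ^ (p - 1) * ‖T‖) ^ p⁻¹ := by
      refine Continuous.rpow_const ?_ fun _ => Or.inr (by positivity)
      refine Continuous.mul (Continuous.rpow_const (by fun_prop) fun _ => Or.inr (by linarith)) ?_
      exact continuous_const
    have := (hc.tendsto x).mono_left (nhdsWithin_le_nhds (s := Ioi 0))
    rwa [sub_self, abs_zero, Real.zero_rpow (by linarith), zero_mul,
      Real.zero_rpow (by positivity)] at this
  refine squeeze_zero' (.of_forall fun _ => norm_nonneg _) ?_ hlim
  filter_upwards [self_mem_nhdsWithin] with y hy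
  rcases le_total x y with h | h
  · rw [abs_of_nonneg (sub_nonneg.2 h)]
    exact norm_weakIntegral_sub_le hp hf hm hT hx h
  · rw [abs_sub_comm, abs_of_nonneg (sub_nonneg.2 h), norm_sub_rev]
    exact norm_weakIntegral_sub_le hp hf hm hT hy h

theorem hardyMean_nonneg (hp : 1 < p) (hf : ∀ x, 0 < x → 0 ≤ f x)
    (hm : WeaklyMeasurableOn f (Ioi 0)) (hT : HasWeakIntegral (fun x => f x ^ p) (Ioi 0) T)
    {x : ℝ} (hx : 0 < x) : 0 ≤ hardyMean f x :=
  smul_nonneg (inv_nonneg.2 hx.le)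
    ((hasWeakIntegral_Ioc hp hf hm hT le_rfl).nonneg measurableSet_Ioc fun t ht => hf t ht.1)

/-- Norm continuity is what passes from the averages to their powers; weak continuity would not. -/
theorem weaklyMeasurableOn_hardyMean_rpow (hp : 1 < p) (hf : ∀ x, 0 < x → 0 ≤ f x)
    (hm : WeaklyMeasurableOn f (Ioi 0)) (hT : HasWeakIntegral (fun x => f x ^ p) (Ioi 0) T) :
    WeaklyMeasurableOn (fun x => hardyMean f x ^ p) (Ioi 0) := by
  have hc : ContinuousOn (fun x => hardyMean f x ^ p) (Ioi 0) := by
    refine ContinuousOn.cfc_nnreal_of_mem_nhdsSet (s := univ) (fun x : NNReal => x ^ p)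
      Filter.univ_mem (continuousOn_hardyMean hp hf hm hT) ?_ ?_
    · exact fun x hx => hardyMean_nonneg hp hf hm hT hx
    · exact (NNReal.continuous_rpow_const (by linarith)).continuousOn
  intro ξ η
  refine ContinuousOn.aemeasurable ?_ measurableSet_Ioi
  exact continuousOn_const.inner (𝕜 := ℂ) (hc.clm_apply continuousOn_const)

/-! ### Hardy's inequality -/

/-- The pointwise trace estimate: the trace of the `p`-th power of the average over `(0, x]` is at
most a weighted average of the traces of `f t ^ p`. -/
theorem tsum_quad_hardyMean_rpow_le (hpq : p.HolderConjugate q) (hf : ∀ x, 0 < x → 0 ≤ f x)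
    (hm : WeaklyMeasurableOn f (Ioi 0)) (hT : HasWeakIntegral (fun x => f x ^ p) (Ioi 0) T)
    {ι : Type*} (b : HilbertBasis ι ℂ H) (htr : ∑' i, quad T (b i) ≠ ∞) {x : ℝ} (hx : 0 < x) :
    ∑' i, quad (hardyMean f x ^ p) (b i) ≤ ENNReal.ofReal (hardyKernel p q x) *
      ∑' i, ∫⁻ t in Ioc 0 x, ENNReal.ofReal (t ^ q⁻¹) * quad (f t ^ p) (b i) := by
  have hp := hpq.lt
  have hp0 := hpq.pos
  have hq0 := hpq.symm.pos
  have hT0 : ∀ t, (0 : H →L[ℂ] H) ≤ f t ^ p := fun t => opRpow_nonneg _ _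
  -- `S` is the weak integral of `G`, dominated by `x ^ q⁻¹ • T` and hence of finite trace
  set G : ℝ → H →L[ℂ] H := fun t => (t ^ q⁻¹) • f t ^ p with hG
  have hG0 : ∀ t ∈ Ioc 0 x, 0 ≤ G t := fun t ht =>
    smul_nonneg (Real.rpow_nonneg ht.1.le _) (hT0 t)
  have hGq : ∀ ξ, ∫⁻ t in Ioc 0 x, quad (G t) ξ
      = ∫⁻ t in Ioc 0 x, ENNReal.ofReal (t ^ q⁻¹) * quad (f t ^ p) ξ := fun ξ =>
    setLIntegral_congr_fun measurableSet_Ioc fun t ht =>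
      quad_smul _ _ (Real.rpow_nonneg ht.1.le _)
  have hGle : ∀ ξ, ∫⁻ t in Ioc 0 x, quad (G t) ξ ≤ ENNReal.ofReal (x ^ q⁻¹) * quad T ξ := by
    intro ξ
    rw [hGq, hT.quad_eq measurableSet_Ioi fun t _ => hT0 t,
      ← lintegral_const_mul' _ _ ENNReal.ofReal_ne_top]
    refine (setLIntegral_mono' measurableSet_Ioc fun t ht => ?_).trans
      (lintegral_mono_set Ioc_subset_Ioi_self)
    gcongr
    · exact ht.1.le
    · exact ht.2
  have hGm : WeaklyMeasurableOn G (Ioc 0 x) := by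
    intro ξ η
    have h1 : AEMeasurable (fun t => inner ℂ ξ ((f t ^ p) η)) (volume.restrict (Ioc 0 x)) :=
      ((hT ξ η).1.mono_set Ioc_subset_Ioi_self).aemeasurable
    have h2 : Measurable fun t : ℝ => ((t ^ q⁻¹ : ℝ) : ℂ) := by fun_prop
    refine (h2.aemeasurable.mul h1).congr (.of_forall fun t => ?_)
    simp [hG, inner_smul_right_eq_smul]
  obtain ⟨S, hS⟩ := weaklyIntegrableOn_of_lintegral_quad_le measurableSet_Ioc hG0 hGm
    (M := ENNReal.ofReal (x ^ q⁻¹) * ENNReal.ofReal ‖T‖)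
    (ENNReal.mul_ne_top ENNReal.ofReal_ne_top ENNReal.ofReal_ne_top)
    fun ξ hξ => (hGle ξ).trans (mul_le_mul_right (quad_le_norm T hξ) _)
  have hSq : ∀ ξ, quad S ξ = ∫⁻ t in Ioc 0 x, quad (G t) ξ := hS.quad_eq measurableSet_Ioc hG0
  simp_rw [← hGq, ← hSq]
  refine tsum_quad_rpow_le b hp (hardyMean_nonneg hp hf hm hT hx) (hS.nonneg measurableSet_Ioc hG0)
    ENNReal.ofReal_ne_top ?_ fun ξ hξ => ?_
  · refine ne_top_of_le_ne_top ?_ (ENNReal.tsum_le_tsum fun i => (hSq (b i)).le.trans (hGle (b i)))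
    rw [ENNReal.tsum_mul_left]
    exact ENNReal.mul_ne_top ENNReal.ofReal_ne_top htr
  · have hF := hasWeakIntegral_Ioc hp hf hm hT (y := x) le_rfl
    rw [hardyMean, quad_smul _ _ (inv_nonneg.2 hx.le), hF.quad_eq measurableSet_Ioc
      fun t ht => hf t ht.1, ENNReal.mul_rpow_of_nonneg _ _ hp0.le,
      ENNReal.ofReal_rpow_of_nonneg (inv_nonneg.2 hx.le) hp0.le, hardyKernel,
      ENNReal.ofReal_mul (by positivity), mul_assoc, hSq, hGq]
    refine mul_le_mul_right ?_ _
    refine (lintegral_Ioc_rpow_le hpq hx ((hm.mono Ioc_subset_Ioi_self).quad ξ)).trans ?_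
    refine mul_le_mul_right ?_ _
    refine setLIntegral_mono' measurableSet_Ioc fun t ht => ?_
    gcongr
    exact quad_rpow_le hp.le (hf t ht.1) hξ

/-- Hardy's inequality for the pointwise traces. Only countably many basis vectors contribute, since
`T` has finite trace, so that sums and integrals commute. -/
theorem lintegral_tsum_quad_hardyMean_le (hpq : p.HolderConjugate q) (hf : ∀ x, 0 < x → 0 ≤ f x)
    (hm : WeaklyMeasurableOn f (Ioi 0)) (hT : HasWeakIntegral (fun x => f x ^ p) (Ioi 0) T)
    {ι : Type*} (b : HilbertBasis ι ℂ H) (htr : ∑' i, quad T (b i) ≠ ∞) :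
    ∫⁻ x in Ioi 0, ∑' i, quad (hardyMean f x ^ p) (b i)
      ≤ ENNReal.ofReal (q ^ p) * ∑' i, quad T (b i) := by
  have hTq : ∀ i, quad T (b i) = ∫⁻ t in Ioi 0, quad (f t ^ p) (b i) := fun i =>
    hT.quad_eq measurableSet_Ioi (fun t _ => opRpow_nonneg _ _) (b i)
  have hφ : ∀ i, AEMeasurable (fun t => quad (f t ^ p) (b i)) (volume.restrict (Ioi 0)) := fun i =>
    WeaklyMeasurableOn.quad (fun ξ η => (hT ξ η).1.aemeasurable) (b i)
  -- the basis vectors outside the countable set `I` contribute to neither side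
  set I : Set ι := Function.support fun i => quad T (b i) with hI
  have hIc : Countable I := (Summable.countable_support_ennreal htr).to_subtype
  have hzero : ∀ x : ℝ, (Function.support fun i =>
      ∫⁻ t in Ioc 0 x, ENNReal.ofReal (t ^ q⁻¹) * quad (f t ^ p) (b i)) ⊆ I := by
    intro x i
    contrapose!
    intro hi
    have h0 : ∫⁻ t in Ioi 0, quad (f t ^ p) (b i) = 0 := by
      rw [← hTq]
      simpa [hI] using hi
    rw [lintegral_eq_zero_iff' (hφ i)] at h0
    rw [Function.mem_support, not_not]
    refine (lintegral_congr_ae ?_).trans lintegral_zero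
    filter_upwards [ae_restrict_of_ae_restrict_of_subset Ioc_subset_Ioi_self h0] with t ht
    rw [ht]
    simp
  have hmono : ∀ i, Measurable fun x : ℝ =>
      ∫⁻ t in Ioc 0 x, ENNReal.ofReal (t ^ q⁻¹) * quad (f t ^ p) (b i) := fun i =>
    Monotone.measurable fun x y hxy => lintegral_mono_set (Ioc_subset_Ioc_right hxy)
  have hk : Measurable fun x => ENNReal.ofReal (hardyKernel p q x) := by
    unfold hardyKernel
    fun_prop
  calc ∫⁻ x in Ioi 0, ∑' i, quad (hardyMean f x ^ p) (b i)
      ≤ ∫⁻ x in Ioi 0, ∑' i : I, ENNReal.ofReal (hardyKernel p q x) *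
          ∫⁻ t in Ioc 0 x, ENNReal.ofReal (t ^ q⁻¹) * quad (f t ^ p) (b i) := by
        refine setLIntegral_mono' measurableSet_Ioi fun x hx => ?_
        rw [ENNReal.tsum_mul_left, tsum_subtype_eq_of_support_subset (hzero x)]
        exact tsum_quad_hardyMean_rpow_le hpq hf hm hT b htr hx
    _ = ∑' i : I, ENNReal.ofReal (q ^ p) * quad T (b i) := by
        rw [lintegral_tsum fun i : I => (hk.fun_mul (hmono i)).aemeasurable]
        refine tsum_congr fun i => ?_
        rw [hTq, lintegral_hardyKernel_mul hpq (hφ i)]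
    _ ≤ _ := by
        rw [ENNReal.tsum_mul_left, tsum_subtype_eq_of_support_subset subset_rfl]

theorem weaklyIntegrableOn_hardyMean_rpow (hpq : p.HolderConjugate q) (hf : ∀ x, 0 < x → 0 ≤ f x)
    (hm : WeaklyMeasurableOn f (Ioi 0)) (hT : HasWeakIntegral (fun x => f x ^ p) (Ioi 0) T)
    {ι : Type*} (b : HilbertBasis ι ℂ H) (htr : ∑' i, quad T (b i) ≠ ∞) :
    WeaklyIntegrableOn (fun x => hardyMean f x ^ p) (Ioi 0) := by
  refine weaklyIntegrableOn_of_lintegral_quad_le measurableSet_Ioi (fun x _ => opRpow_nonneg _ _)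
    (weaklyMeasurableOn_hardyMean_rpow hpq.lt hf hm hT)
    (ENNReal.mul_ne_top (ENNReal.ofReal_ne_top (r := q ^ p)) htr) fun ξ hξ => ?_
  refine (lintegral_mono fun x => ?_).trans (lintegral_tsum_quad_hardyMean_le hpq hf hm hT b htr)
  simpa [hξ] using quad_le_tsum b (opRpow_nonneg (hardyMean f x) p) ξ

theorem tsum_quad_weakIntegral_hardyMean_le (hpq : p.HolderConjugate q)
    (hf : ∀ x, 0 < x → 0 ≤ f x) (hm : WeaklyMeasurableOn f (Ioi 0))
    (hT : HasWeakIntegral (fun x => f x ^ p) (Ioi 0) T)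
    {ι : Type*} (b : HilbertBasis ι ℂ H) (htr : ∑' i, quad T (b i) ≠ ∞) {R : H →L[ℂ] H}
    (hR : HasWeakIntegral (fun x => hardyMean f x ^ p) (Ioi 0) R) :
    ∑' i, quad R (b i) ≤ ENNReal.ofReal (q ^ p) * ∑' i, quad T (b i) := by
  simp_rw [hR.quad_eq measurableSet_Ioi (fun x _ => opRpow_nonneg _ _) (b _)]
  exact (tsum_lintegral_le_lintegral_tsum fun i =>
    (weaklyMeasurableOn_hardyMean_rpow hpq.lt hf hm hT).quad (b i)).trans
      (lintegral_tsum_quad_hardyMean_le hpq hf hm hT b htr)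

end Hardy

/-- Hardy's inequality for traces, with the existence of all the integrals involved. -/
theorem hardy_trace_inequality {p : ℝ} (hp : 1 < p) {f : ℝ → H →L[ℂ] H}
    (hf : ∀ x, 0 < x → 0 ≤ f x) (hm : WeaklyMeasurableOn f (Ioi 0))
    (hi : WeaklyIntegrableOn (fun x => f x ^ p) (Ioi 0))
    (htc : IsTraceClass (weakIntegral (fun x => f x ^ p) (Ioi 0))) :
    (∀ x, 0 < x → WeaklyIntegrableOn f (Ioc 0 x)) ∧
    WeaklyIntegrableOn (fun x => hardyMean f x ^ p) (Ioi 0) ∧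
    IsTraceClass (weakIntegral (fun x => hardyMean f x ^ p) (Ioi 0)) ∧
    (trace (weakIntegral (fun x => hardyMean f x ^ p) (Ioi 0))).re ≤
      (p / (p - 1)) ^ p * (trace (weakIntegral (fun x => f x ^ p) (Ioi 0))).re := by
  have hpq : p.HolderConjugate (p / (p - 1)) := Real.HolderConjugate.conjExponent hp
  have hq0 := hpq.symm.pos
  have hT := hasWeakIntegral_weakIntegral hi
  have hT0 := hT.nonneg measurableSet_Ioi fun x _ => opRpow_nonneg _ _
  have htr := (isTraceClass_iff hT0).1 htc
  have hA := weaklyIntegrableOn_hardyMean_rpow hpq hf hm hT (onb H) (htr _ _)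
  have hR := hasWeakIntegral_weakIntegral hA
  have hR0 := hR.nonneg measurableSet_Ioi fun x _ => opRpow_nonneg _ _
  have hle := fun (w : Set H) (b : HilbertBasis w ℂ H) =>
    tsum_quad_weakIntegral_hardyMean_le hpq hf hm hT b (htr w b) hR
  refine ⟨fun x _ => ⟨_, hasWeakIntegral_Ioc hp hf hm hT le_rfl⟩, hA,
    (isTraceClass_iff hR0).2 fun w b => ?_, ?_⟩
  · exact ne_top_of_le_ne_top (ENNReal.mul_ne_top ENNReal.ofReal_ne_top (htr w b)) (hle w b)
  · rw [re_trace_eq hR0, re_trace_eq hT0]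
    have h := ENNReal.toReal_mono (ENNReal.mul_ne_top ENNReal.ofReal_ne_top (htr _ _))
      (hle _ (onb H))
    rwa [ENNReal.toReal_mul, ENNReal.toReal_ofReal (by positivity)] at h

end

/-! ### Sharpness of the constant -/

section

variable {H : Type u} [NormedAddCommGroup H] [InnerProductSpace ℂ H]

/-- The rank one operator `ξ ↦ ⟨u, ξ⟩ u`, which for a unit vector `u` is an orthogonal
projection. -/
abbrev rankOneProj (u : H) : H →L[ℂ] H := InnerProductSpace.rankOne ℂ u u

theorem rankOneProj_nonneg (u : H) : 0 ≤ rankOneProj u :=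
  (ContinuousLinearMap.nonneg_iff_isPositive _).2 (InnerProductSpace.isPositive_rankOne_self u)

theorem quad_rankOneProj (u ξ : H) :
    quad (rankOneProj u) ξ = ENNReal.ofReal (‖inner ℂ ξ u‖ ^ 2) := by
  rw [quad, InnerProductSpace.rankOne_apply, inner_smul_right, ← inner_conj_symm u ξ,
    Complex.conj_mul']
  norm_cast

theorem hasWeakIntegral_smul {φ : ℝ → ℝ} {s : Set ℝ} (hφ : IntegrableOn φ s) (P : H →L[ℂ] H) :
    HasWeakIntegral (fun x => φ x • P) s ((∫ x in s, φ x) • P) := by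
  intro ξ η
  have h : ∀ r : ℝ, inner ℂ ξ ((r • P) η) = (r : ℂ) * inner ℂ ξ (P η) := fun r => by
    simp [inner_smul_right_eq_smul]
  simp_rw [h]
  exact ⟨hφ.ofReal.mul_const _, by rw [integral_mul_const, integral_complex_ofReal]⟩

variable [CompleteSpace H]

/-- Both sides agree on `u` and on its orthogonal complement, which consist of eigenvectors. -/
theorem smul_rankOneProj_rpow {p : ℝ} (hp : 1 < p) {u : H} (hu : ‖u‖ = 1) {c : ℝ} (hc : 0 ≤ c) :
    (c • rankOneProj u) ^ p = (c ^ p) • rankOneProj u := by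
  have h0 : 0 ≤ c • rankOneProj u := smul_nonneg hc (rankOneProj_nonneg u)
  have huu : inner ℂ u u = (1 : ℂ) := by simp [inner_self_eq_norm_sq_to_K, hu]
  have h1 : ((c • rankOneProj u) ^ p) u = (c ^ p) • u :=
    rpow_apply_of_eigenvector hp.le h0 (by simp [hu])
  ext ξ
  set η := ξ - (inner ℂ u ξ : ℂ) • u with hη
  have hη0 : inner ℂ u η = (0 : ℂ) := by
    rw [hη, inner_sub_right, inner_smul_right, huu, mul_one, sub_self]
  have h2 : ((c • rankOneProj u) ^ p) η = ((0 : ℝ) ^ p) • η :=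
    rpow_apply_of_eigenvector hp.le h0 (by simp [hη0])
  rw [Real.zero_rpow (by linarith), zero_smul, hη, map_sub, map_smul, h1, sub_eq_zero] at h2
  rw [h2, smul_apply, InnerProductSpace.rankOne_apply, smul_comm]

/-- The test functions `t ^ (-a)` on `(0, 1]`, for `a` close to `1 / p`, show that no constant below
`(1 - a) ^ (-p)` is admissible: on `(0, 1]` averaging multiplies them by `(1 - a)⁻¹`. -/
theorem le_of_hardy_trace_inequality {p : ℝ} (hp : 1 < p) {C : ℝ} {u : H} (hu : ‖u‖ = 1)
    (h : ∀ f : ℝ → H →L[ℂ] H, (∀ x, 0 < x → 0 ≤ f x) → WeaklyMeasurableOn f (Ioi 0) →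
      WeaklyIntegrableOn (fun x => f x ^ p) (Ioi 0) →
      IsTraceClass (weakIntegral (fun x => f x ^ p) (Ioi 0)) →
      (trace (weakIntegral (fun x => hardyMean f x ^ p) (Ioi 0))).re ≤
        C * (trace (weakIntegral (fun x => f x ^ p) (Ioi 0))).re)
    {a : ℝ} (ha0 : 0 < a) (ha : a < p⁻¹) : ((1 - a)⁻¹) ^ p ≤ C := by
  have hp0 : 0 < p := by linarith
  have hap : a * p < 1 := by rwa [lt_inv_comm₀ ha0 hp0, ← one_div, lt_div_iff₀ ha0, mul_comm] at ha
  have ha1 : a < 1 := ha.trans (inv_lt_one_of_one_lt₀ hp)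
  set P := rankOneProj u
  set φ : ℝ → ℝ := (Ioc 0 1).indicator fun t => t ^ (-a) with hφ
  have hφ0 : ∀ t, 0 ≤ φ t := fun t =>
    indicator_nonneg (fun t ht => Real.rpow_nonneg ht.1.le _) t
  have hφm : Measurable φ := Measurable.indicator (by fun_prop) measurableSet_Ioc
  set f : ℝ → H →L[ℂ] H := fun t => φ t • P
  have hf : ∀ x, 0 < x → 0 ≤ f x := fun x _ => smul_nonneg (hφ0 x) (rankOneProj_nonneg u)
  have hm : WeaklyMeasurableOn f (Ioi 0) := by
    intro ξ η
    have h1 : Measurable fun t => (φ t : ℂ) * inner ℂ ξ (P η) := by fun_prop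
    refine h1.aemeasurable.congr (.of_forall fun t => ?_)
    simp [f, inner_smul_right_eq_smul]
  have hpow : ∀ b : ℝ, b < 1 → ∀ x : ℝ, 0 ≤ x →
      IntegrableOn (fun t : ℝ => t ^ (-b)) (Ioc 0 x) ∧
        ∫ t in Ioc 0 x, t ^ (-b) = x ^ (1 - b) / (1 - b) := by
    intro b hb x hx
    refine ⟨(intervalIntegrable_iff_integrableOn_Ioc_of_le hx).1
      (intervalIntegral.intervalIntegrable_rpow' (by linarith)), ?_⟩
    rw [← intervalIntegral.integral_of_le hx, integral_rpow (Or.inl (by linarith)),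
      Real.zero_rpow (by linarith), sub_zero, neg_add_eq_sub]
  -- the `p`-th power of the test function
  have hfp : (fun x => f x ^ p) = fun x => (φ x ^ p) • P :=
    funext fun x => smul_rankOneProj_rpow hp hu (hφ0 x)
  have hφp : (fun x => φ x ^ p) = (Ioc 0 1).indicator fun t => t ^ (-(a * p)) := by
    ext t
    by_cases ht : t ∈ Ioc (0 : ℝ) 1
    · rw [hφ, indicator_of_mem ht, indicator_of_mem ht, ← Real.rpow_mul ht.1.le, neg_mul]
    · rw [hφ, indicator_of_notMem ht, indicator_of_notMem ht, Real.zero_rpow hp0.ne']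
  have hint : IntegrableOn (fun x => φ x ^ p) (Ioi 0) := by
    rw [hφp]
    exact ((integrable_indicator_iff measurableSet_Ioc).2 (hpow _ hap 1 zero_le_one).1).integrableOn
  have hval : ∫ x in Ioi 0, φ x ^ p = (1 - a * p)⁻¹ := by
    rw [hφp, integral_indicator measurableSet_Ioc, Measure.restrict_restrict measurableSet_Ioc,
      inter_eq_left.2 Ioc_subset_Ioi_self, (hpow _ hap 1 zero_le_one).2, Real.one_rpow, one_div]
  have hT := hasWeakIntegral_smul hint P
  rw [hval, ← hfp] at hT
  have hpos : 0 < (1 - a * p)⁻¹ := inv_pos.2 (by linarith)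
  have hT0 := hT.nonneg measurableSet_Ioi fun x _ => opRpow_nonneg _ _
  have hTtr : ∀ (w : Set H) (b : HilbertBasis w ℂ H),
      ∑' i, quad ((1 - a * p)⁻¹ • P) (b i) = ENNReal.ofReal (1 - a * p)⁻¹ := by
    intro w b
    simp_rw [quad_smul _ _ hpos.le, P, quad_rankOneProj]
    rw [ENNReal.tsum_mul_left, tsum_ofReal_norm_inner_sq, hu]
    simp
  have hi : WeaklyIntegrableOn (fun x => f x ^ p) (Ioi 0) := ⟨_, hT⟩
  have htc : IsTraceClass (weakIntegral (fun x => f x ^ p) (Ioi 0)) := by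
    rw [hT.weakIntegral_eq, isTraceClass_iff hT0]
    intro w b
    rw [hTtr]
    exact ENNReal.ofReal_ne_top
  -- the integral of the powers of the averages exists, so its trace is not the junk value `0`
  obtain ⟨-, hA, hAtc, -⟩ := hardy_trace_inequality hp hf hm hi htc
  have hC := h f hf hm hi htc
  have hR := hasWeakIntegral_weakIntegral hA
  have hR0 := hR.nonneg measurableSet_Ioi fun x _ => opRpow_nonneg _ _
  rw [isTraceClass_iff hR0] at hAtc
  rw [re_trace_eq hR0, hT.weakIntegral_eq, re_trace_eq hT0, hTtr,
    ENNReal.toReal_ofReal hpos.le] at hC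
  -- the averages on `(0, 1]`
  have hmean : ∀ x ∈ Ioc (0 : ℝ) 1, quad (hardyMean f x ^ p) u
      = ENNReal.ofReal (((1 - a)⁻¹) ^ p * x ^ (-(a * p))) := by
    intro x hx
    have hφx : EqOn φ (fun t => t ^ (-a)) (Ioc 0 x) := fun t ht =>
      indicator_of_mem (show t ∈ Ioc (0 : ℝ) 1 from ⟨ht.1, ht.2.trans hx.2⟩) _
    have hF := hasWeakIntegral_smul
      ((integrableOn_congr_fun hφx measurableSet_Ioc).2 (hpow a ha1 x hx.1.le).1) P
    rw [setIntegral_congr_fun measurableSet_Ioc hφx, (hpow a ha1 x hx.1.le).2] at hF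
    have h1a : 0 < 1 - a := by linarith
    have hxr := Real.rpow_pos_of_pos hx.1 (1 - a)
    have hxa := Real.rpow_pos_of_pos hx.1 (-a)
    rw [hardyMean, HasWeakIntegral.weakIntegral_eq hF, smul_smul,
      smul_rankOneProj_rpow hp hu (mul_nonneg (inv_nonneg.2 hx.1.le) (by positivity)),
      quad_smul _ _ (Real.rpow_nonneg (mul_nonneg (inv_nonneg.2 hx.1.le) (by positivity)) _),
      quad_rankOneProj]
    have e1 : x⁻¹ * (x ^ (1 - a) / (1 - a)) = (1 - a)⁻¹ * x ^ (-a) := by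
      rw [sub_eq_add_neg 1 a, Real.rpow_add hx.1, Real.rpow_one]
      have := hx.1.ne'
      field_simp
    rw [e1, Real.mul_rpow (inv_nonneg.2 h1a.le) hxa.le, ← Real.rpow_mul hx.1.le, neg_mul]
    simp [inner_self_eq_norm_sq_to_K, hu]
  have hlow : ENNReal.ofReal (((1 - a)⁻¹) ^ p * (1 - a * p)⁻¹)
      ≤ ∑' i, quad (weakIntegral (fun x => hardyMean f x ^ p) (Ioi 0)) (onb H i) := by
    have h1 := quad_le_tsum (onb H) hR0 u
    rw [hu, one_pow, ENNReal.ofReal_one, one_mul] at h1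
    refine le_trans ?_ h1
    rw [hR.quad_eq measurableSet_Ioi fun x _ => opRpow_nonneg _ _]
    refine le_trans (le_of_eq ?_) (lintegral_mono_set
      (show Ioc (0 : ℝ) 1 ⊆ Ioi 0 from Ioc_subset_Ioi_self))
    rw [setLIntegral_congr_fun measurableSet_Ioc hmean, ← ofReal_integral_eq_lintegral_ofReal
      ((hpow _ hap 1 zero_le_one).1.const_mul _) ((ae_restrict_iff' measurableSet_Ioc).2
      (.of_forall fun x hx => mul_nonneg (Real.rpow_nonneg (inv_nonneg.2 (by linarith)) _)
        (Real.rpow_nonneg hx.1.le _))), integral_const_mul, (hpow _ hap 1 zero_le_one).2,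
      Real.one_rpow, one_div]
  have hlow' := (ENNReal.ofReal_le_iff_le_toReal (hAtc _ _)).1 hlow
  exact le_of_mul_le_mul_right (hlow'.trans hC) hpos

end

end TracialHardy

end

theorem mainTheorem2 {H : Type*} [NormedAddCommGroup H] [InnerProductSpace ℂ H]
    [CompleteSpace H] (p : ℝ) (hp : 1 < p) :
    (∀ f : ℝ → H →L[ℂ] H,
      (∀ x, 0 < x → 0 ≤ f x) →
      TracialHardy.WeaklyMeasurableOn f (Set.Ioi 0) →
      TracialHardy.WeaklyIntegrableOn (fun x => f x ^ p) (Set.Ioi 0) →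
      TracialHardy.IsTraceClass (TracialHardy.weakIntegral (fun x => f x ^ p) (Set.Ioi 0)) →
      (∀ x, 0 < x → TracialHardy.WeaklyIntegrableOn f (Set.Ioc 0 x)) ∧
      TracialHardy.WeaklyIntegrableOn (fun x => TracialHardy.hardyMean f x ^ p) (Set.Ioi 0) ∧
      TracialHardy.IsTraceClass
        (TracialHardy.weakIntegral (fun x => TracialHardy.hardyMean f x ^ p) (Set.Ioi 0)) ∧
      (TracialHardy.trace
        (TracialHardy.weakIntegral (fun x => TracialHardy.hardyMean f x ^ p) (Set.Ioi 0))).re ≤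
        (p / (p - 1)) ^ p *
          (TracialHardy.trace
            (TracialHardy.weakIntegral (fun x => f x ^ p) (Set.Ioi 0))).re) ∧
    (Nontrivial H → ∀ C : ℝ,
      (∀ f : ℝ → H →L[ℂ] H,
        (∀ x, 0 < x → 0 ≤ f x) →
        TracialHardy.WeaklyMeasurableOn f (Set.Ioi 0) →
        TracialHardy.WeaklyIntegrableOn (fun x => f x ^ p) (Set.Ioi 0) →
        TracialHardy.IsTraceClass (TracialHardy.weakIntegral (fun x => f x ^ p) (Set.Ioi 0)) →
        (TracialHardy.trace
          (TracialHardy.weakIntegral (fun x => TracialHardy.hardyMean f x ^ p) (Set.Ioi 0))).re ≤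
          C * (TracialHardy.trace
            (TracialHardy.weakIntegral (fun x => f x ^ p) (Set.Ioi 0))).re) →
      (p / (p - 1)) ^ p ≤ C) := by
  refine ⟨fun f hf hm hi htc => TracialHardy.hardy_trace_inequality hp hf hm hi htc,
    fun _ C h => ?_⟩
  obtain ⟨v, hv⟩ := exists_ne (0 : H)
  have hp0 : 0 < p := by linarith
  have hp1 : 0 < p⁻¹ := inv_pos.2 hp0
  have hp2 : p⁻¹ < 1 := inv_lt_one_of_one_lt₀ hp
  have hlim : Filter.Tendsto (fun a : ℝ => ((1 - a)⁻¹) ^ p) (nhdsWithin p⁻¹ (Set.Iio p⁻¹))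
      (nhds (((1 - p⁻¹)⁻¹) ^ p)) := by
    refine Filter.Tendsto.mono_left ?_ nhdsWithin_le_nhds
    refine Filter.Tendsto.rpow_const ?_ (Or.inr hp0.le)
    exact (tendsto_const_nhds.sub Filter.tendsto_id).inv₀ (by linarith)
  have he : (1 - p⁻¹)⁻¹ = p / (p - 1) := by
    have : p - 1 ≠ 0 := by linarith
    field_simp
  rw [he] at hlim
  refine le_of_tendsto hlim ?_
  filter_upwards [Ioo_mem_nhdsLT hp1] with a ha
  exact TracialHardy.le_of_hardy_trace_inequality hp (TracialHardy.norm_normalized hv) h ha.1 ha.2
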